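/- Let $\{(X_i,Y_i)\}_{i\in\mathbb N}$ be a discrete-time stochastic process with finite alphabet $\mathcal X\times\mathcal Y$ (not necessarily IID), write $X^n=(X_1,\dots,X_n)$, $Y^n=(Y_1,\dots,Y_n)$, and let $P_{X^n,Y^n}$ be the PMF of $(X^n,Y^n)$. Fix $\rho>0$ and put $\tilde\rho=1/(1+\rho)$. All logarithms are to base $2$. For $\alpha\in(0,1)$ let $$H_\alpha(X^n|Y^n)=\frac{\alpha}{1-\alpha}\log\sum_{y}\Bigl(\sum_{x}P_{X^n,Y^n}(x,y)^\alpha\Bigr)^{1/\alpha},$$ and suppose that the conditional Rényi entropy-rate $H_{\tilde\rho}(\boldsymbol X|\boldsymbol Y)=\lim_{n\to\infty}H_{\tilde\rho}(X^n|Y^n)/n$ exists. Let $R_1,R_2>0$. For each $n$, an encoder is a conditional PMF $\Pr[M_1=m_1,M_2=m_2\mid X^n=x,Y^n=y]$ on $\mathcal M_1\times\mathcal M_2$, where $\mathcal M_k=\{1,\dots,\lfloor 2^{nR_k}\rfloor\}$ for $k\in\{1,2\}$. A guessing function (for $X^n$) given side-information $z$ is a bijection $G(\cdot|z)$ from $\mathcal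 X^n$ onto $\{1,\dots,|\mathcal X|^n\}$. Bob's ambiguity $\mathscr A_{\mathrm B}$ is, in the guessing version, $$\min_G\mathbb E\bigl[G(X^n|Y^n,M_1,M_2)^\rho\bigr],$$ and, in the list version, $\mathbb E\bigl[|\mathcal L^{Y^n}_{M_1,M_2}|^\rho\bigr]$, where $\mathcal L^{y}_{m_1,m_2}=\{x:\Pr[X^n=x\mid Y^n=y,M_1=m_1,M_2=m_2]>0\}$. In both versions Eve's ambiguity is $$\mathscr A_{\mathrm E}=\min_{G_1,G_2}\mathbb E\bigl[\min\{G_1(X^n|Y^n,M_1)^\rho,\;G_2(X^n|Y^n,M_2)^\rho\}\bigr].$$ A real number $E$ is an achievable ambiguity-exponent if there is a sequence (in $n$) of encoders for which $\lim_{n\to\infty}\mathscr A_{\mathrm B}=1$ and $\liminf_{n\to\infty}\frac1n\log\mathscr A_{\mathrm E}\ge E$. The privacy-exponent $\overline{E_{\mathrm E}}$ is the supremum of all achievable ambiguity-exponents, and it is $-\infty$ if there are none. Then, in the guessing version as well as in the list version, $$\overline{E_{\mathrm E}}=\begin{cases}\rho\,\min\{R_1,R_2,H_{\tilde\rho}(\boldsymbol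 X|\boldsymbol Y)\},& R_1+R_2>H_{\tilde\rho}(\boldsymbol X|\boldsymbol Y),\\-\infty,&R_1+R_2<H_{\tilde\rho}(\boldsymbol X|\boldsymbol Y).\end{cases}$$ -/

import Mathlib

open MeasureTheory Filter Topology

noncomputable section

namespace DistStorage

/-- A guessing function for a chance variable with alphabet `A`: a bijection from `A` onto
`{1, …, |A|}`, encoded through `Fin |A| = {0, …, |A| - 1}`; see `guessNumber` for the shift. -/
abbrev GuessingFunction (A : Type*) [Fintype A] : Type _ := A ≃ Fin (Fintype.card A)

/-- The position in `{1, …, |A|}` of the question "Is `X = x`?" in the guessing order `G`. -/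
def guessNumber {A : Type*} [Fintype A] (G : GuessingFunction A) (x : A) : ℕ := (G x : ℕ) + 1

/-- A stochastic encoder: the conditional PMF of the pair of hints `(M₁, M₂)` given
`(X, Y) = (x, y)`. -/
abbrev Encoder (A B M₁ M₂ : Type*) : Type _ := A → B → PMF (M₁ × M₂)

section Ambiguity

variable {A B M₁ M₂ : Type*} [Fintype A] [Fintype B] [Fintype M₁] [Fintype M₂]

/-- The probability of `(X, Y, M₁, M₂) = (x, y, m₁, m₂)` when `(X, Y)` has PMF `P` and the hints
are drawn by the encoder `enc`. -/
def jointProb (P : PMF (A × B)) (enc : Encoder A B M₁ M₂) (x : A) (y : B) (m₁ : M₁) (m₂ : M₂) :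
    ℝ :=
  (P (x, y)).toReal * (enc x y (m₁, m₂)).toReal

/-- The expectation of `f (X, Y, M₁, M₂)`. -/
def expect (P : PMF (A × B)) (enc : Encoder A B M₁ M₂) (f : A → B → M₁ → M₂ → ℝ) : ℝ :=
  ∑ x, ∑ y, ∑ m₁, ∑ m₂, jointProb P enc x y m₁ m₂ * f x y m₁ m₂

/-- Bob's ambiguity in the guessing version: the minimum, over all guessing functions that use
`(Y, M₁, M₂)`, of the `ρ`-th moment of the number of guesses. The infimum is over a finite
nonempty set. -/
def bobGuessAmbiguity (ρ : ℝ) (P : PMF (A × B)) (enc : Encoder A B M₁ M₂) : ℝ :=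
  ⨅ G : B → M₁ → M₂ → GuessingFunction A,
    expect P enc fun x y m₁ m₂ => (guessNumber (G y m₁ m₂) x : ℝ) ^ ρ

/-- The posterior probability of `X = x` given `(Y, M₁, M₂) = (y, m₁, m₂)`. -/
def posterior (P : PMF (A × B)) (enc : Encoder A B M₁ M₂) (x : A) (y : B) (m₁ : M₁) (m₂ : M₂) :
    ℝ :=
  jointProb P enc x y m₁ m₂ / ∑ x', jointProb P enc x' y m₁ m₂

/-- Bob's list: all `x` with positive posterior probability given `(y, m₁, m₂)`. -/
def bobList (P : PMF (A × B)) (enc : Encoder A B M₁ M₂) (y : B) (m₁ : M₁) (m₂ : M₂) : Set A :=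
  {x | 0 < posterior P enc x y m₁ m₂}

/-- Bob's ambiguity in the list version: the `ρ`-th moment of the size of his list. -/
def bobListAmbiguity (ρ : ℝ) (P : PMF (A × B)) (enc : Encoder A B M₁ M₂) : ℝ :=
  expect P enc fun _ y m₁ m₂ => ((bobList P enc y m₁ m₂).ncard : ℝ) ^ ρ

/-- Eve's ambiguity: she sees `Y` and one of the hints, and a genie that knows everything reveals
to her the hint that leads to fewer guesses. The infimum is over a finite nonempty set. -/
def eveAmbiguity (ρ : ℝ) (P : PMF (A × B)) (enc : Encoder A B M₁ M₂) : ℝ :=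
  ⨅ G : (B → M₁ → GuessingFunction A) × (B → M₂ → GuessingFunction A),
    expect P enc fun x y m₁ m₂ =>
      min ((guessNumber (G.1 y m₁) x : ℝ) ^ ρ) ((guessNumber (G.2 y m₂) x : ℝ) ^ ρ)

/-- The conditional Rényi entropy (in bits, after Arimoto) of order `α`, for `0 < α`, `α ≠ 1`. -/
def condRenyiEntropy (α : ℝ) (P : PMF (A × B)) : ℝ :=
  α / (1 - α) * Real.logb 2 (∑ y, (∑ x, (P (x, y)).toReal ^ α) ^ (1 / α))

end Ambiguity

/-- The two versions of the problem, which differ in the definition of Bob's ambiguity. -/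
inductive Version : Type
  | guessing
  | list

/-- Bob's ambiguity in either version of the problem. -/
def bobAmbiguity {A B M₁ M₂ : Type*} [Fintype A] [Fintype B] [Fintype M₁] [Fintype M₂]
    (v : Version) (ρ : ℝ) (P : PMF (A × B)) (enc : Encoder A B M₁ M₂) : ℝ :=
  match v with
  | Version.guessing => bobGuessAmbiguity ρ P enc
  | Version.list => bobListAmbiguity ρ P enc

/-- The PMF of `(X^n, Y^n)`, the first `n` terms of the process `(X_i, Y_i)`. -/
def blockPMF {Ω 𝒳 𝒴 : Type*} [MeasurableSpace Ω] (μ : Measure Ω) [IsProbabilityMeasure μ]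
    [Fintype 𝒳] [MeasurableSpace 𝒳] [MeasurableSingletonClass 𝒳]
    [Fintype 𝒴] [MeasurableSpace 𝒴] [MeasurableSingletonClass 𝒴]
    (X : ℕ → Ω → 𝒳) (Y : ℕ → Ω → 𝒴) (hX : ∀ i, Measurable (X i)) (hY : ∀ i, Measurable (Y i))
    (n : ℕ) : PMF ((Fin n → 𝒳) × (Fin n → 𝒴)) :=
  haveI : IsProbabilityMeasure
      (μ.map fun ω => ((fun i : Fin n => X i ω), (fun i : Fin n => Y i ω))) :=
    Measure.isProbabilityMeasure_map
      ((measurable_pi_lambda _ fun i : Fin n => hX i).prodMk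
        (measurable_pi_lambda _ fun i : Fin n => hY i)).aemeasurable
  (μ.map fun ω => ((fun i : Fin n => X i ω), (fun i : Fin n => Y i ω))).toPMF

/-- The alphabet `{1, …, 2^{nR}}` of a hint of rate `R` at blocklength `n`; its size is `2^{nR}`
rounded down to an integer. -/
abbrev HintSet (R : ℝ) (n : ℕ) : Type := Fin ⌊(2 : ℝ) ^ ((n : ℝ) * R)⌋₊

section Asymptotics

variable {𝒳 𝒴 : Type*} [Fintype 𝒳] [Fintype 𝒴]

/-- `H` is the conditional Rényi entropy-rate of order `α`: the limit of `H_α(X^n | Y^n) / n`. -/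
def IsCondRenyiEntropyRate (α : ℝ) (P : (n : ℕ) → PMF ((Fin n → 𝒳) × (Fin n → 𝒴))) (H : ℝ) :
    Prop :=
  Tendsto (fun n : ℕ => condRenyiEntropy α (P n) / n) atTop (𝓝 H)

/-- `E` is an achievable ambiguity-exponent for the rate pair `(R₁, R₂)`: some sequence of
stochastic encoders drives Bob's ambiguity to `1` while the exponential growth rate of Eve's
ambiguity is at least `E`. -/
def IsAchievable (v : Version) (ρ R₁ R₂ : ℝ) (P : (n : ℕ) → PMF ((Fin n → 𝒳) × (Fin n → 𝒴)))
    (E : ℝ) : Prop :=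
  ∃ enc : (n : ℕ) → Encoder (Fin n → 𝒳) (Fin n → 𝒴) (HintSet R₁ n) (HintSet R₂ n),
    Tendsto (fun n : ℕ => bobAmbiguity v ρ (P n) (enc n)) atTop (𝓝 1) ∧
    (E : EReal) ≤
      liminf (fun n : ℕ => ((Real.logb 2 (eveAmbiguity ρ (P n) (enc n)) / n : ℝ) : EReal)) atTop

/-- The privacy-exponent: the supremum of all achievable ambiguity-exponents, as an extended real
number; it is `⊥ = -∞` if there is none. -/
def privacyExponent (v : Version) (ρ R₁ R₂ : ℝ)
    (P : (n : ℕ) → PMF ((Fin n → 𝒳) × (Fin n → 𝒴))) : EReal :=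
  sSup {e : EReal | ∃ E : ℝ, IsAchievable v ρ R₁ R₂ P E ∧ e = (E : EReal)}

end Asymptotics

end DistStorage

end

/-! Everything is measured against `renyiSum`, i.e. `T = 2 ^ (ρ * H)` with `H` the conditional Rényi
entropy of order `1 / (1 + ρ)`. Guessing in decreasing order of probability has `ρ`-th moment at
most `T`. Conversely, Hölder's inequality (`rpow_sum_rpow_le_mul`) bounds every guessing moment from
below once the sum of the inverse ranks is controlled. For one guessing order that sum is a harmonic
number, which at blocklength `n` is of order `n` and so costs nothing in the exponent.

Converse. Eve may ignore the hints, which gives `T`. She may also use one hint and interleave Bob's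
orders over the values of the other, which costs `|M₁| ^ ρ` or `|M₂| ^ ρ` times Bob's ambiguity.
Hölder over triples `(x, m₁, m₂)` gives `T ≤ 𝒜_B * (|M₁| * |M₂| * harmonic) ^ ρ`, so Bob's ambiguity
cannot tend to `1` if `R₁ + R₂ < H`.

Achievability. Let `x` have a description `(s, v₁, v₂)`, of total rate slightly above `H`, that
almost determines `x` given `y`. With a uniform key `u`, the hints are `(s + u, v₁)` and `(u, v₂)`.
Together they reveal the description; separately, each reveals only its own `vₖ`. Hence Eve's
ambiguity is at least `T / ((|V₁| + |V₂|) * harmonic) ^ ρ`, and making the private parts as short as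
the hint sizes permit yields the exponent `ρ * min {R₁, R₂, H}`. -/

namespace DistStorage

noncomputable section

/-! ### Guessing orders and Hölder's inequality for guessing moments -/

section Finite

/-- Sort by the key `k`: whatever precedes `x` has a key no larger than that of `x`, however ties
are broken. -/
theorem exists_guessingFunction_le_ncard {A α : Type*} [Fintype A] [LinearOrder α] (k : A → α) :
    ∃ G : GuessingFunction A, ∀ x, guessNumber G x ≤ {x' | k x' ≤ k x}.ncard := by
  classical
  let e := Fintype.equivFin A
  let f : Fin (Fintype.card A) → α := k ∘ e.symm
  have hm : Monotone (f ∘ Tuple.sort f) := Tuple.monotone_sort f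
  refine ⟨e.trans (Tuple.sort f).symm, fun x => ?_⟩
  set G : GuessingFunction A := e.trans (Tuple.sort f).symm with hG
  have hk : ∀ z, k z = (f ∘ Tuple.sort f) (G z) := by
    intro z; simp [hG, f]
  have hsub : (G.symm '' (Finset.Iic (G x) : Finset (Fin _)) : Set A) ⊆ {x' | k x' ≤ k x} := by
    rintro _ ⟨j, hj, rfl⟩
    simp only [Set.mem_ofPred_eq]
    rw [hk, hk x]
    apply hm
    simpa using hj
  have := Set.ncard_le_ncard hsub (Set.toFinite _)
  rw [Set.ncard_image_of_injective _ G.symm.injective, Set.ncard_coe_finset, Fin.card_Iic] at this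
  exact this

theorem guessNumber_pos {A : Type*} [Fintype A] (G : GuessingFunction A) (x : A) :
    0 < guessNumber G x := Nat.succ_pos _

theorem one_le_guessNumber_rpow {A : Type*} [Fintype A] {ρ : ℝ} (hρ : 0 ≤ ρ)
    (G : GuessingFunction A) (x : A) : 1 ≤ (guessNumber G x : ℝ) ^ ρ :=
  Real.one_le_rpow (by exact_mod_cast guessNumber_pos G x) hρ

theorem ncard_guessNumber_le {A : Type*} [Fintype A] (G : GuessingFunction A) (k : ℕ) :
    {x | guessNumber G x ≤ k}.ncard ≤ k := by
  have h : {x | guessNumber G x ≤ k}.ncard ≤ (Finset.range k : Set ℕ).ncard := by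
    refine Set.ncard_le_ncard_of_injOn (fun x => (G x : ℕ)) ?_ ?_ (Set.toFinite _)
    · intro x hx
      simp only [guessNumber, Set.mem_ofPred_eq] at hx
      simp only [Finset.coe_range, Set.mem_Iio]
      omega
    · intro x _ z _ hxz
      exact G.injective (Fin.ext hxz)
  simpa using h

/-- Interleaving a family of guessing orders costs at most a factor equal to the size of the
family. -/
theorem exists_interleaving {A M : Type*} [Fintype A] [Fintype M] (Gs : M → GuessingFunction A) :
    ∃ G : GuessingFunction A, ∀ x m,
      guessNumber G x ≤ Fintype.card M * guessNumber (Gs m) x := by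
  obtain ⟨G, hG⟩ := exists_guessingFunction_le_ncard (fun x => ⨅ m, guessNumber (Gs m) x)
  refine ⟨G, fun x m => (hG x).trans ?_⟩
  have : Nonempty M := ⟨m⟩
  set k := ⨅ m, guessNumber (Gs m) x
  have hk : k ≤ guessNumber (Gs m) x := ciInf_le (OrderBot.bddBelow _) m
  have hsub : {x' | ⨅ m, guessNumber (Gs m) x' ≤ k} ⊆ ⋃ m, {x' | guessNumber (Gs m) x' ≤ k} := by
    intro x' hx'
    obtain ⟨m', hm'⟩ := exists_eq_ciInf_of_finite (f := fun m => guessNumber (Gs m) x')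
    refine Set.mem_iUnion.2 ⟨m', ?_⟩
    simp only [Set.mem_ofPred_eq] at hx' ⊢
    rw [hm']; exact hx'
  calc _ ≤ (⋃ m, {x' | guessNumber (Gs m) x' ≤ k}).ncard :=
        Set.ncard_le_ncard hsub (Set.toFinite _)
    _ ≤ ∑ m, {x' | guessNumber (Gs m) x' ≤ k}.ncard := Set.ncard_iUnion_le_of_fintype _
    _ ≤ ∑ _m : M, k := Finset.sum_le_sum fun m _ => ncard_guessNumber_le _ _
    _ = Fintype.card M * k := by simp
    _ ≤ _ := Nat.mul_le_mul_left _ hk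

theorem sum_inv_guessNumber {A : Type*} [Fintype A] (G : GuessingFunction A) :
    ∑ x, ((guessNumber G x : ℝ))⁻¹ = (harmonic (Fintype.card A) : ℝ) := by
  refine (Equiv.sum_comp G (fun i => (((i : ℕ) + 1 : ℕ) : ℝ)⁻¹)).trans ?_
  rw [Fin.sum_univ_eq_sum_range (fun i => ((i + 1 : ℕ) : ℝ)⁻¹)]
  simp [harmonic]

/-- Hölder with exponents `1 + ρ` and `(1 + ρ) / ρ`, after writing `p ^ (1/(1+ρ))` as `(p * g ^ ρ) ^
(1/(1+ρ)) * (g⁻¹) ^ (ρ/(1+ρ))`. With `g` a number of guesses, this is Arikan's lower bound; `g` need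
not come from a single guessing order. -/
theorem rpow_sum_rpow_le_mul {ι : Type*} (s : Finset ι) {ρ : ℝ} (hρ : 0 < ρ) (p g : ι → ℝ)
    (hp : ∀ i, 0 ≤ p i) (hg : ∀ i, 0 < g i) :
    (∑ i ∈ s, p i ^ (1 / (1 + ρ))) ^ (1 + ρ) ≤
      (∑ i ∈ s, p i * g i ^ ρ) * (∑ i ∈ s, (g i)⁻¹) ^ ρ := by
  have h1 : 0 < 1 + ρ := by linarith
  have hpq : (1 + ρ).HolderConjugate ((1 + ρ) / ρ) := by
    rw [Real.holderConjugate_iff]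
    refine ⟨by linarith, ?_⟩
    field_simp
  have hp' : ∀ i, 0 ≤ p i * g i ^ ρ := fun i => mul_nonneg (hp i) (Real.rpow_nonneg (hg i).le _)
  have hg' : ∀ i, 0 ≤ (g i)⁻¹ := fun i => (inv_pos.2 (hg i)).le
  have key := Real.inner_le_Lp_mul_Lq_of_nonneg s hpq
    (f := fun i => (p i * g i ^ ρ) ^ (1 / (1 + ρ))) (g := fun i => (g i)⁻¹ ^ (ρ / (1 + ρ)))
    (fun i _ => Real.rpow_nonneg (hp' i) _) (fun i _ => Real.rpow_nonneg (hg' i) _)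
  have e1 : ∀ i, (p i * g i ^ ρ) ^ (1 / (1 + ρ)) * (g i)⁻¹ ^ (ρ / (1 + ρ)) =
      p i ^ (1 / (1 + ρ)) := by
    intro i
    rw [Real.mul_rpow (hp i) (Real.rpow_nonneg (hg i).le _), ← Real.rpow_mul (hg i).le,
      Real.inv_rpow (hg i).le, mul_assoc, mul_one_div, mul_inv_cancel₀, mul_one]
    exact (Real.rpow_pos_of_pos (hg i) _).ne'
  have e2 : ∀ i, ((p i * g i ^ ρ) ^ (1 / (1 + ρ))) ^ (1 + ρ) = p i * g i ^ ρ := by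
    intro i
    rw [← Real.rpow_mul (hp' i), one_div_mul_cancel h1.ne', Real.rpow_one]
  have e3 : ∀ i, ((g i)⁻¹ ^ (ρ / (1 + ρ))) ^ ((1 + ρ) / ρ) = (g i)⁻¹ := by
    intro i
    rw [← Real.rpow_mul (hg' i), div_mul_div_cancel₀ h1.ne', div_self hρ.ne', Real.rpow_one]
  simp only [e1, e2, e3] at key
  have hA : 0 ≤ ∑ i ∈ s, p i * g i ^ ρ := Finset.sum_nonneg fun i _ => hp' i
  have hB : 0 ≤ ∑ i ∈ s, (g i)⁻¹ := Finset.sum_nonneg fun i _ => hg' i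
  refine (Real.rpow_le_rpow (Finset.sum_nonneg fun i _ => Real.rpow_nonneg (hp i) _) key
    h1.le).trans_eq ?_
  rw [Real.mul_rpow (Real.rpow_nonneg hA _) (Real.rpow_nonneg hB _), ← Real.rpow_mul hA,
    ← Real.rpow_mul hB, one_div_mul_cancel h1.ne', Real.rpow_one]
  congr 2
  field_simp

theorem rpow_sum_le_sum_rpow {ι : Type*} (s : Finset ι) {a : ℝ} (h0 : 0 < a) (h1 : a ≤ 1)
    (p : ι → ℝ) (hp : ∀ i, 0 ≤ p i) : (∑ i ∈ s, p i) ^ a ≤ ∑ i ∈ s, p i ^ a := by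
  classical
  induction s using Finset.induction_on with
  | empty => simp [Real.zero_rpow h0.ne']
  | insert i s hi ih =>
    rw [Finset.sum_insert hi, Finset.sum_insert hi]
    exact (Real.rpow_add_le_add_rpow (hp i) (Finset.sum_nonneg fun i _ => hp i) h0.le h1).trans
      (by linarith)

end Finite

/-! ### One-shot bounds on the ambiguities of Bob and Eve -/

section Expectation

variable {A B M₁ M₂ : Type*} [Fintype A] [Fintype B] [Fintype M₁] [Fintype M₂]
  (P : PMF (A × B)) (enc : Encoder A B M₁ M₂)

theorem _root_.PMF.sum_toReal_eq_one {C : Type*} [Fintype C] (p : PMF C) :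
    ∑ c, (p c).toReal = 1 := by
  rw [← ENNReal.toReal_sum fun c _ => p.apply_ne_top c, ← tsum_fintype (L := .unconditional C),
    p.tsum_coe, ENNReal.toReal_one]

omit [Fintype A] [Fintype B] [Fintype M₁] [Fintype M₂] in
theorem jointProb_nonneg (x : A) (y : B) (m₁ : M₁) (m₂ : M₂) : 0 ≤ jointProb P enc x y m₁ m₂ :=
  mul_nonneg ENNReal.toReal_nonneg ENNReal.toReal_nonneg

omit [Fintype A] [Fintype B] in
theorem sum_jointProb (x : A) (y : B) :
    ∑ m₁, ∑ m₂, jointProb P enc x y m₁ m₂ = (P (x, y)).toReal := by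
  have := (enc x y).sum_toReal_eq_one
  rw [Fintype.sum_prod_type] at this
  simp only [jointProb, ← Finset.mul_sum, this, mul_one]

theorem sum_toReal_prod : ∑ x, ∑ y, (P (x, y)).toReal = 1 := by
  have := P.sum_toReal_eq_one
  rwa [Fintype.sum_prod_type] at this

theorem expect_of_source (f : A → B → ℝ) :
    expect P enc (fun x y _ _ => f x y) = ∑ x, ∑ y, (P (x, y)).toReal * f x y := by
  simp only [expect, ← Finset.sum_mul, sum_jointProb]

theorem expect_mono {f g : A → B → M₁ → M₂ → ℝ}
    (h : ∀ x y m₁ m₂, 0 < jointProb P enc x y m₁ m₂ → f x y m₁ m₂ ≤ g x y m₁ m₂) :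
    expect P enc f ≤ expect P enc g := by
  refine Finset.sum_le_sum fun x _ => Finset.sum_le_sum fun y _ => Finset.sum_le_sum fun m₁ _ =>
    Finset.sum_le_sum fun m₂ _ => ?_
  rcases (jointProb_nonneg P enc x y m₁ m₂).eq_or_lt with h0 | h0
  · simp [← h0]
  · exact mul_le_mul_of_nonneg_left (h _ _ _ _ h0) h0.le

theorem expect_const_mul (c : ℝ) (f : A → B → M₁ → M₂ → ℝ) :
    expect P enc (fun x y m₁ m₂ => c * f x y m₁ m₂) = c * expect P enc f := by
  simp only [expect, Finset.mul_sum]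
  congr! 4
  ring

theorem one_le_expect {f : A → B → M₁ → M₂ → ℝ} (h : ∀ x y m₁ m₂, 1 ≤ f x y m₁ m₂) :
    1 ≤ expect P enc f := by
  have := expect_of_source P enc (fun _ _ => 1)
  simp only [mul_one, sum_toReal_prod] at this
  rw [← this]
  exact expect_mono P enc fun _ _ _ _ _ => h _ _ _ _

instance {A : Type*} [Fintype A] : Nonempty (GuessingFunction A) := ⟨Fintype.equivFin A⟩

variable {ρ : ℝ}

theorem one_le_bobGuessAmbiguity (hρ : 0 ≤ ρ) : 1 ≤ bobGuessAmbiguity ρ P enc :=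
  le_ciInf fun _ => one_le_expect P enc fun _ _ _ _ => one_le_guessNumber_rpow hρ _ _

theorem bobGuessAmbiguity_le (hρ : 0 ≤ ρ) (G : B → M₁ → M₂ → GuessingFunction A) :
    bobGuessAmbiguity ρ P enc ≤
      expect P enc fun x y m₁ m₂ => (guessNumber (G y m₁ m₂) x : ℝ) ^ ρ :=
  ciInf_le ⟨1, Set.forall_mem_range.2 fun _ =>
    one_le_expect P enc fun _ _ _ _ => one_le_guessNumber_rpow hρ _ _⟩ G

theorem one_le_eveAmbiguity (hρ : 0 ≤ ρ) : 1 ≤ eveAmbiguity ρ P enc :=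
  le_ciInf fun _ => one_le_expect P enc fun _ _ _ _ =>
    le_min (one_le_guessNumber_rpow hρ _ _) (one_le_guessNumber_rpow hρ _ _)

theorem eveAmbiguity_le (hρ : 0 ≤ ρ)
    (G : (B → M₁ → GuessingFunction A) × (B → M₂ → GuessingFunction A)) :
    eveAmbiguity ρ P enc ≤ expect P enc fun x y m₁ m₂ =>
      min ((guessNumber (G.1 y m₁) x : ℝ) ^ ρ) ((guessNumber (G.2 y m₂) x : ℝ) ^ ρ) :=
  ciInf_le ⟨1, Set.forall_mem_range.2 fun _ => one_le_expect P enc fun _ _ _ _ =>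
    le_min (one_le_guessNumber_rpow hρ _ _) (one_le_guessNumber_rpow hρ _ _)⟩ G

/-- Guess the elements of the list before all others: a true `x` is always on the list, so its rank
is at most the size of the list. -/
theorem bobGuessAmbiguity_le_bobListAmbiguity (hρ : 0 ≤ ρ) :
    bobGuessAmbiguity ρ P enc ≤ bobListAmbiguity ρ P enc := by
  classical
  choose G hG using fun y m₁ m₂ => exists_guessingFunction_le_ncard
    (fun x => if x ∈ bobList P enc y m₁ m₂ then (0 : ℕ) else 1)
  refine (bobGuessAmbiguity_le P enc hρ G).trans (expect_mono P enc fun x y m₁ m₂ hpos => ?_)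
  refine Real.rpow_le_rpow (Nat.cast_nonneg _) (Nat.cast_le.2 ((hG y m₁ m₂ x).trans ?_)) hρ
  have hx : x ∈ bobList P enc y m₁ m₂ :=
    div_pos hpos (hpos.trans_le (Finset.single_le_sum
      (fun x' _ => jointProb_nonneg P enc x' y m₁ m₂) (Finset.mem_univ x)))
  refine Set.ncard_le_ncard (fun x' hx' => ?_) (Set.toFinite _)
  by_contra hn
  simp [hx, hn] at hx'

/-- Eve uses the second hint only and interleaves Bob's orders over all `m₁`; her order for the
first hint is irrelevant. -/
theorem eveAmbiguity_le_left (hρ : 0 ≤ ρ) :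
    eveAmbiguity ρ P enc ≤ (Fintype.card M₁ : ℝ) ^ ρ * bobGuessAmbiguity ρ P enc := by
  have h0 : 0 ≤ (Fintype.card M₁ : ℝ) ^ ρ := by positivity
  rw [bobGuessAmbiguity, Real.mul_iInf_of_nonneg h0]
  refine le_ciInf fun G => ?_
  choose G₂ hG₂ using fun y m₂ => exists_interleaving fun m₁ => G y m₁ m₂
  rw [← expect_const_mul]
  refine (eveAmbiguity_le P enc hρ (fun _ _ => Fintype.equivFin A, G₂)).trans
    (expect_mono P enc fun x y m₁ m₂ _ => (min_le_right _ _).trans ?_)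
  rw [← Real.mul_rpow (Nat.cast_nonneg _) (Nat.cast_nonneg _)]
  exact Real.rpow_le_rpow (Nat.cast_nonneg _) (by exact_mod_cast hG₂ y m₂ x m₁) hρ

theorem eveAmbiguity_le_right (hρ : 0 ≤ ρ) :
    eveAmbiguity ρ P enc ≤ (Fintype.card M₂ : ℝ) ^ ρ * bobGuessAmbiguity ρ P enc := by
  have h0 : 0 ≤ (Fintype.card M₂ : ℝ) ^ ρ := by positivity
  rw [bobGuessAmbiguity, Real.mul_iInf_of_nonneg h0]
  refine le_ciInf fun G => ?_
  choose G₁ hG₁ using fun y m₁ => exists_interleaving fun m₂ => G y m₁ m₂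
  rw [← expect_const_mul]
  refine (eveAmbiguity_le P enc hρ (G₁, fun _ _ => Fintype.equivFin A)).trans
    (expect_mono P enc fun x y m₁ m₂ _ => (min_le_left _ _).trans ?_)
  rw [← Real.mul_rpow (Nat.cast_nonneg _) (Nat.cast_nonneg _)]
  exact Real.rpow_le_rpow (Nat.cast_nonneg _) (by exact_mod_cast hG₁ y m₁ x m₂) hρ

/-- The quantity `2 ^ (ρ * H_{1/(1+ρ)}(X | Y))`. -/
def renyiSum (ρ : ℝ) (P : PMF (A × B)) : ℝ :=
  ∑ y, (∑ x, (P (x, y)).toReal ^ (1 / (1 + ρ))) ^ (1 + ρ)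

theorem logb_renyiSum (hρ : 0 < ρ) :
    Real.logb 2 (renyiSum ρ P) = ρ * condRenyiEntropy (1 / (1 + ρ)) P := by
  have h1 : (1 / (1 + ρ)) / (1 - 1 / (1 + ρ)) = 1 / ρ := by
    have : 1 + ρ ≠ 0 := by linarith
    have h : 1 - 1 / (1 + ρ) = ρ / (1 + ρ) := by field_simp; ring
    rw [h]; field_simp
  rw [condRenyiEntropy, h1, one_div_one_div, ← mul_assoc, mul_one_div_cancel hρ.ne', one_mul,
    renyiSum]

/-- Guessing in decreasing order of probability attains the Rényi bound. -/
theorem exists_guessing_le_renyiSum (hρ : 0 < ρ) :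
    ∃ G : B → GuessingFunction A,
      ∑ x, ∑ y, (P (x, y)).toReal * (guessNumber (G y) x : ℝ) ^ ρ ≤ renyiSum ρ P := by
  choose G hG using fun y => exists_guessingFunction_le_ncard fun x => -(P (x, y)).toReal
  refine ⟨G, ?_⟩
  rw [Finset.sum_comm]
  refine Finset.sum_le_sum fun y _ => ?_
  have h1 : 0 < 1 + ρ := by linarith
  set p : A → ℝ := fun x => (P (x, y)).toReal with hp
  have hp0 : ∀ x, 0 ≤ p x := fun x => ENNReal.toReal_nonneg
  set T : ℝ := ∑ x, p x ^ (1 / (1 + ρ)) with hT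
  have hT0 : 0 ≤ T := Finset.sum_nonneg fun x _ => Real.rpow_nonneg (hp0 x) _
  have hx : ∀ x, p x * (guessNumber (G y) x : ℝ) ^ ρ ≤ p x ^ (1 / (1 + ρ)) * T ^ ρ := by
    intro x
    rcases (hp0 x).eq_or_lt with h0 | h0
    · rw [← h0, zero_mul]
      positivity
    have hr : 0 < p x ^ (1 / (1 + ρ)) := Real.rpow_pos_of_pos h0 _
    -- Every `x'` ranked no later than `x` is at least as likely, so it contributes at least `p x ^
    -- (1/(1+ρ))` to `T`.
    have hg : (guessNumber (G y) x : ℝ) * p x ^ (1 / (1 + ρ)) ≤ T := by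
      classical
      have hs : ({x' | -(p x') ≤ -(p x)} : Set A) =
          (Finset.univ.filter fun x' => p x ≤ p x' : Finset A) := by ext; simp
      have hc := hG y x
      change _ ≤ ({x' | -(p x') ≤ -(p x)} : Set A).ncard at hc
      rw [hs, Set.ncard_coe_finset] at hc
      calc (guessNumber (G y) x : ℝ) * p x ^ (1 / (1 + ρ))
          ≤ ((Finset.univ.filter fun x' => p x ≤ p x').card : ℝ) * p x ^ (1 / (1 + ρ)) := by
            gcongr
        _ = ∑ x' ∈ Finset.univ.filter fun x' => p x ≤ p x', p x ^ (1 / (1 + ρ)) := by simp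
        _ ≤ ∑ x' ∈ Finset.univ.filter fun x' => p x ≤ p x', p x' ^ (1 / (1 + ρ)) := by
            refine Finset.sum_le_sum fun x' hx' => ?_
            exact Real.rpow_le_rpow h0.le (Finset.mem_filter.1 hx').2 (by positivity)
        _ ≤ T := Finset.sum_le_sum_of_subset_of_nonneg (Finset.filter_subset _ _)
            fun x' _ _ => Real.rpow_nonneg (hp0 x') _
    have hsplit : p x = p x ^ (1 / (1 + ρ)) * (p x ^ (1 / (1 + ρ))) ^ ρ := by
      rw [← Real.rpow_mul h0.le, ← Real.rpow_add h0]
      rw [show 1 / (1 + ρ) + 1 / (1 + ρ) * ρ = 1 by field_simp, Real.rpow_one]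
    calc p x * (guessNumber (G y) x : ℝ) ^ ρ
        = p x ^ (1 / (1 + ρ)) * ((guessNumber (G y) x : ℝ) * p x ^ (1 / (1 + ρ))) ^ ρ := by
          rw [Real.mul_rpow (Nat.cast_nonneg _) hr.le]
          conv_lhs => rw [hsplit]
          ring
      _ ≤ _ := by gcongr
  refine (Finset.sum_le_sum fun x _ => hx x).trans_eq ?_
  rw [← Finset.sum_mul, Real.rpow_add' hT0 h1.ne', Real.rpow_one]

theorem eveAmbiguity_le_renyiSum (hρ : 0 < ρ) : eveAmbiguity ρ P enc ≤ renyiSum ρ P := by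
  obtain ⟨G, hG⟩ := exists_guessing_le_renyiSum P hρ
  refine (eveAmbiguity_le P enc hρ.le (fun y _ => G y, fun y _ => G y)).trans ?_
  simp only [min_self]
  rwa [expect_of_source P enc fun x y => (guessNumber (G y) x : ℝ) ^ ρ]

theorem one_le_renyiSum (hρ : 0 < ρ) : 1 ≤ renyiSum ρ P :=
  (one_le_eveAmbiguity P (fun _ _ => PMF.pure ((), ())) hρ.le).trans
    (eveAmbiguity_le_renyiSum P _ hρ)

/-- Hölder over `(x, m₁, m₂)`: each pair of hints contributes one harmonic sum. Splitting the mass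
`P (x, y)` among the hint pairs can only increase the sum of powers, as the exponent `1 / (1 + ρ)`
is at most `1`. -/
theorem renyiSum_le_bobGuessAmbiguity_mul (hρ : 0 < ρ) :
    renyiSum ρ P ≤ bobGuessAmbiguity ρ P enc *
      ((Fintype.card M₁ * Fintype.card M₂ : ℝ) * (harmonic (Fintype.card A) : ℝ)) ^ ρ := by
  have h1 : 0 < 1 + ρ := by linarith
  have hh : (0 : ℝ) ≤ (harmonic (Fintype.card A) : ℝ) := by
    rw [← sum_inv_guessNumber (Fintype.equivFin A)]
    positivity
  rw [bobGuessAmbiguity, Real.iInf_mul_of_nonneg (by positivity)]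
  refine le_ciInf fun G => ?_
  have hexp : (expect P enc fun x y m₁ m₂ => (guessNumber (G y m₁ m₂) x : ℝ) ^ ρ) =
      ∑ y, ∑ i : A × M₁ × M₂, jointProb P enc i.1 y i.2.1 i.2.2 *
        (guessNumber (G y i.2.1 i.2.2) i.1 : ℝ) ^ ρ := by
    rw [expect, Finset.sum_comm]
    simp only [Fintype.sum_prod_type]
  rw [hexp, renyiSum, Finset.sum_mul]
  refine Finset.sum_le_sum fun y _ => ?_
  have key := rpow_sum_rpow_le_mul (Finset.univ : Finset (A × M₁ × M₂)) hρ
    (fun i => jointProb P enc i.1 y i.2.1 i.2.2)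
    (fun i => (guessNumber (G y i.2.1 i.2.2) i.1 : ℝ))
    (fun i => jointProb_nonneg P enc _ _ _ _)
    (fun i => by exact_mod_cast guessNumber_pos _ _)
  have hinv : ∑ i : A × M₁ × M₂, (guessNumber (G y i.2.1 i.2.2) i.1 : ℝ)⁻¹ =
      (Fintype.card M₁ * Fintype.card M₂ : ℝ) * (harmonic (Fintype.card A) : ℝ) := by
    rw [Fintype.sum_prod_type_right]
    simp only [sum_inv_guessNumber]
    simp [Fintype.card_prod]
  rw [hinv] at key
  refine le_trans (Real.rpow_le_rpow (Finset.sum_nonneg fun x _ =>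
    Real.rpow_nonneg ENNReal.toReal_nonneg _) ?_ h1.le) key
  rw [Fintype.sum_prod_type]
  refine Finset.sum_le_sum fun x _ => ?_
  have hs : (P (x, y)).toReal = ∑ i : M₁ × M₂, jointProb P enc x y i.1 i.2 := by
    rw [Fintype.sum_prod_type, sum_jointProb]
  rw [hs]
  refine rpow_sum_le_sum_rpow _ (by positivity) ?_ _ fun i => jointProb_nonneg P enc _ _ _ _
  rw [div_le_one h1]; linarith

end Expectation

theorem _root_.PMF.sum_map_toReal_mul {C D : Type*} [Fintype C] [Fintype D] (p : PMF C)
    (h : C → D) (g : D → ℝ) :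
    ∑ d, ((p.map h) d).toReal * g d = ∑ c, (p c).toReal * g (h c) := by
  classical
  have hd : ∀ d, ((p.map h) d).toReal = ∑ c, if d = h c then (p c).toReal else 0 := by
    intro d
    rw [PMF.map_apply, tsum_fintype, ENNReal.toReal_sum]
    · refine Finset.sum_congr rfl fun c _ => ?_
      split_ifs with hc
      · rfl
      · exact ENNReal.toReal_zero
    · intro c _
      split_ifs
      · exact p.apply_ne_top c
      · exact ENNReal.zero_ne_top
  simp only [hd, Finset.sum_mul, ite_mul, zero_mul]
  rw [Finset.sum_comm]
  simp

/-! ### The one-time-pad encoder -/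

section Keyed

variable {A B M₁ M₂ S V₁ V₂ : Type*} [Fintype A] [Fintype B] [Fintype M₁] [Fintype M₂]
  [Fintype S] [Nonempty S] [AddCommGroup S] [Fintype V₁] [Fintype V₂]

/-- The encoder that splits a description `f x y = (s, v₁, v₂)` of `x` between the hints: the part
`s` is protected by a one-time pad with a uniform key, which is the shared part of the second
hint. -/
def keyedEncoder (f : A → B → S × V₁ × V₂) (i₁ : S × V₁ ↪ M₁) (i₂ : S × V₂ ↪ M₂) :
    Encoder A B M₁ M₂ := fun x y =>
  (PMF.uniformOfFintype S).map fun u =>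
    (i₁ ((f x y).1 + u, (f x y).2.1), i₂ (u, (f x y).2.2))

variable (P : PMF (A × B)) (f : A → B → S × V₁ × V₂) (i₁ : S × V₁ ↪ M₁) (i₂ : S × V₂ ↪ M₂)

omit [Fintype V₁] [Fintype V₂] in
theorem expect_keyedEncoder (g : A → B → M₁ → M₂ → ℝ) :
    expect P (keyedEncoder f i₁ i₂) g =
      ∑ x, ∑ y, ∑ u, (P (x, y)).toReal * (Fintype.card S : ℝ)⁻¹ *
        g x y (i₁ ((f x y).1 + u, (f x y).2.1)) (i₂ (u, (f x y).2.2)) := by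
  refine Finset.sum_congr rfl fun x _ => Finset.sum_congr rfl fun y _ => ?_
  have h := PMF.sum_map_toReal_mul (PMF.uniformOfFintype S)
    (fun u => (i₁ ((f x y).1 + u, (f x y).2.1), i₂ (u, (f x y).2.2)))
    (fun m : M₁ × M₂ => g x y m.1 m.2)
  rw [Fintype.sum_prod_type] at h
  simp only [jointProb, keyedEncoder, mul_assoc, ← Finset.mul_sum]
  rw [h]
  simp [Finset.mul_sum]

omit [Fintype V₁] [Fintype V₂] in
-- The second hint contains the key, so the two hints determine `u` and then the whole description;
-- the list lies in one fibre of `f · y`.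
theorem bobListAmbiguity_keyedEncoder_le {ρ : ℝ} (hρ : 0 ≤ ρ) :
    bobListAmbiguity ρ P (keyedEncoder f i₁ i₂) ≤
      ∑ x, ∑ y, (P (x, y)).toReal * ({x' | f x' y = f x y}.ncard : ℝ) ^ ρ := by
  rw [← expect_of_source P (keyedEncoder f i₁ i₂)
    fun x y => ({x' | f x' y = f x y}.ncard : ℝ) ^ ρ]
  refine expect_mono P _ fun x y m₁ m₂ hpos => ?_
  have hdec : ∀ x', 0 < jointProb P (keyedEncoder f i₁ i₂) x' y m₁ m₂ →
      ∃ u, m₁ = i₁ ((f x' y).1 + u, (f x' y).2.1) ∧ m₂ = i₂ (u, (f x' y).2.2) := by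
    intro x' hx'
    have hne : keyedEncoder f i₁ i₂ x' y (m₁, m₂) ≠ 0 := by
      intro h0
      simp [jointProb, h0] at hx'
    rw [← PMF.mem_support_iff, keyedEncoder, PMF.mem_support_map_iff] at hne
    obtain ⟨u, -, hu⟩ := hne
    simp only [Prod.mk.injEq] at hu
    exact ⟨u, hu.1.symm, hu.2.symm⟩
  refine Real.rpow_le_rpow (Nat.cast_nonneg _) (Nat.cast_le.2
    (Set.ncard_le_ncard (fun x' hx' => ?_) (Set.toFinite _))) hρ
  have hpos' : 0 < jointProb P (keyedEncoder f i₁ i₂) x' y m₁ m₂ := by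
    refine (jointProb_nonneg P _ x' y m₁ m₂).lt_of_ne fun h0 => ?_
    simp [bobList, posterior, ← h0] at hx'
  obtain ⟨u, hu₁, hu₂⟩ := hdec x hpos
  obtain ⟨u', hu₁', hu₂'⟩ := hdec x' hpos'
  have e₁ := i₁.injective (hu₁.symm.trans hu₁')
  have e₂ := i₂.injective (hu₂.symm.trans hu₂')
  simp only [Prod.mk.injEq] at e₁ e₂
  obtain ⟨rfl, e₂⟩ := e₂
  have e₃ := add_right_cancel e₁.1
  exact (Prod.ext e₃ (Prod.ext e₁.2 e₂)).symm

theorem harmonic_cast_nonneg (n : ℕ) : (0 : ℝ) ≤ (harmonic n : ℝ) := by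
  rw [← Fintype.card_fin n, ← sum_inv_guessNumber (Fintype.equivFin (Fin n))]
  positivity

omit [Nonempty S] [AddCommGroup S] in
-- Secrecy of the pad: for fixed `x` the padded value runs through all of `S` as the key does, so
-- the permutation `σ x` drops out of the sum. The unpadded value `w x` is handled by summing over
-- all of `V`, whence the factor `|V|`.
theorem sum_inv_guessNumber_le {V : Type*} [Fintype V] (G : S → V → GuessingFunction A)
    (w : A → V) (σ : A → S ≃ S) :
    ∑ x, ∑ u, ((guessNumber (G (σ x u) (w x)) x : ℕ) : ℝ)⁻¹ ≤
      Fintype.card S * (Fintype.card V * (harmonic (Fintype.card A) : ℝ)) := by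
  calc ∑ x, ∑ u, ((guessNumber (G (σ x u) (w x)) x : ℕ) : ℝ)⁻¹
      = ∑ x, ∑ u, ((guessNumber (G u (w x)) x : ℕ) : ℝ)⁻¹ :=
        Finset.sum_congr rfl fun x _ =>
          Equiv.sum_comp (σ x) fun u => ((guessNumber (G u (w x)) x : ℕ) : ℝ)⁻¹
    _ ≤ ∑ x, ∑ u, ∑ v, ((guessNumber (G u v) x : ℕ) : ℝ)⁻¹ :=
        Finset.sum_le_sum fun x _ => Finset.sum_le_sum fun u _ =>
          Finset.single_le_sum (f := fun v => ((guessNumber (G u v) x : ℕ) : ℝ)⁻¹)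
            (fun v _ => by positivity) (Finset.mem_univ (w x))
    _ = ∑ u, ∑ v, ∑ x, ((guessNumber (G u v) x : ℕ) : ℝ)⁻¹ := by
        rw [Finset.sum_comm]
        exact Finset.sum_congr rfl fun u _ => Finset.sum_comm
    _ = _ := by simp [sum_inv_guessNumber]

/-- Hölder over pairs `(x, u)` of mass `P (x, y) / |S|`. Spreading the mass over the keys produces
`|S| ^ ρ` on the left, and the inverse ranks produce the same factor on the right, so the size of
the key cancels. -/
theorem renyiSum_le_eveAmbiguity_keyedEncoder_mul {ρ : ℝ} (hρ : 0 < ρ) :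
    renyiSum ρ P ≤ eveAmbiguity ρ P (keyedEncoder f i₁ i₂) *
      ((Fintype.card V₁ + Fintype.card V₂ : ℝ) * (harmonic (Fintype.card A) : ℝ)) ^ ρ := by
  have h1 : 0 < 1 + ρ := by linarith
  have hh := harmonic_cast_nonneg (Fintype.card A)
  have hS : (0 : ℝ) < Fintype.card S := by exact_mod_cast Fintype.card_pos
  rw [eveAmbiguity, Real.iInf_mul_of_nonneg (by positivity)]
  refine le_ciInf fun G => ?_
  set g₁ : B → A × S → ℝ := fun y i =>
    (guessNumber (G.1 y (i₁ ((f i.1 y).1 + i.2, (f i.1 y).2.1))) i.1 : ℝ) with hg₁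
  set g₂ : B → A × S → ℝ := fun y i =>
    (guessNumber (G.2 y (i₂ (i.2, (f i.1 y).2.2))) i.1 : ℝ) with hg₂
  have hg₁0 : ∀ y i, 0 < g₁ y i := fun y i => Nat.cast_pos.2 (guessNumber_pos _ _)
  have hg₂0 : ∀ y i, 0 < g₂ y i := fun y i => Nat.cast_pos.2 (guessNumber_pos _ _)
  have hexp : (expect P (keyedEncoder f i₁ i₂) fun x y m₁ m₂ =>
      min ((guessNumber (G.1 y m₁) x : ℝ) ^ ρ) ((guessNumber (G.2 y m₂) x : ℝ) ^ ρ)) =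
      ∑ y, ∑ i : A × S, (P (i.1, y)).toReal * (Fintype.card S : ℝ)⁻¹ *
        (min (g₁ y i) (g₂ y i)) ^ ρ := by
    rw [expect_keyedEncoder, Finset.sum_comm]
    refine Finset.sum_congr rfl fun y _ => ?_
    rw [Fintype.sum_prod_type]
    refine Finset.sum_congr rfl fun x _ => Finset.sum_congr rfl fun u _ => ?_
    congr 1
    exact ((Real.monotoneOn_rpow_Ici_of_exponent_nonneg hρ.le).map_min
      (hg₁0 y (x, u)).le (hg₂0 y (x, u)).le).symm
  rw [hexp, renyiSum, Finset.sum_mul]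
  refine Finset.sum_le_sum fun y _ => ?_
  have key := rpow_sum_rpow_le_mul (Finset.univ : Finset (A × S)) hρ
    (fun i => (P (i.1, y)).toReal * (Fintype.card S : ℝ)⁻¹) (fun i => min (g₁ y i) (g₂ y i))
    (fun i => by positivity) (fun i => lt_min (hg₁0 y i) (hg₂0 y i))
  have hinv : ∑ i, (min (g₁ y i) (g₂ y i))⁻¹ ≤ Fintype.card S *
      ((Fintype.card V₁ + Fintype.card V₂ : ℝ) * (harmonic (Fintype.card A) : ℝ)) := by
    -- The first hint shows the key shifted by the protected part, the second shows the key itself.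
    have b₁ := sum_inv_guessNumber_le (fun u v => G.1 y (i₁ (u, v)))
      (fun x => (f x y).2.1) (fun x => Equiv.addLeft (f x y).1)
    have b₂ := sum_inv_guessNumber_le (fun u v => G.2 y (i₂ (u, v)))
      (fun x => (f x y).2.2) (fun _ => Equiv.refl S)
    -- The genie costs only a sum: the inverse of a minimum is at most the sum of the inverses.
    have hle : ∀ i, (min (g₁ y i) (g₂ y i))⁻¹ ≤ (g₁ y i)⁻¹ + (g₂ y i)⁻¹ := by
      intro i
      have := inv_pos.2 (hg₁0 y i)
      have := inv_pos.2 (hg₂0 y i)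
      rcases min_choice (g₁ y i) (g₂ y i) with h | h <;> rw [h] <;> linarith
    refine (Finset.sum_le_sum fun i _ => hle i).trans ?_
    rw [Finset.sum_add_distrib, Fintype.sum_prod_type, Fintype.sum_prod_type]
    refine (add_le_add b₁ b₂).trans_eq ?_
    ring
  have hlhs : (∑ i : A × S, ((P (i.1, y)).toReal * (Fintype.card S : ℝ)⁻¹) ^ (1 / (1 + ρ))) ^
      (1 + ρ) = (∑ x, (P (x, y)).toReal ^ (1 / (1 + ρ))) ^ (1 + ρ) *
        (Fintype.card S : ℝ) ^ ρ := by
    have hT : 0 ≤ ∑ x, (P (x, y)).toReal ^ (1 / (1 + ρ)) :=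
      Finset.sum_nonneg fun x _ => Real.rpow_nonneg ENNReal.toReal_nonneg _
    have hsum : ∑ i : A × S, ((P (i.1, y)).toReal * (Fintype.card S : ℝ)⁻¹) ^ (1 / (1 + ρ)) =
        (∑ x, (P (x, y)).toReal ^ (1 / (1 + ρ))) *
          (Fintype.card S * (Fintype.card S : ℝ)⁻¹ ^ (1 / (1 + ρ))) := by
      rw [Fintype.sum_prod_type, Finset.sum_mul]
      refine Finset.sum_congr rfl fun x _ => ?_
      simp only [Finset.sum_const, Finset.card_univ, nsmul_eq_mul]
      rw [Real.mul_rpow ENNReal.toReal_nonneg (by positivity)]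
      ring
    rw [hsum, Real.mul_rpow hT (by positivity), Real.mul_rpow hS.le (by positivity),
      ← Real.rpow_mul (by positivity), one_div_mul_cancel h1.ne', Real.rpow_one,
      Real.rpow_add hS, Real.rpow_one]
    field_simp
  rw [hlhs] at key
  have hSρ : 0 < (Fintype.card S : ℝ) ^ ρ := Real.rpow_pos_of_pos hS _
  refine le_of_mul_le_mul_right (key.trans ?_) hSρ
  rw [mul_assoc, ← Real.mul_rpow (by positivity) hS.le]
  refine mul_le_mul_of_nonneg_left (Real.rpow_le_rpow ?_ ?_ hρ.le) ?_
  · exact Finset.sum_nonneg fun i _ => inv_nonneg.2 (lt_min (hg₁0 y i) (hg₂0 y i)).le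
  · rw [mul_comm _ (Fintype.card S : ℝ)]
    exact hinv
  · refine Finset.sum_nonneg fun i _ => mul_nonneg (by positivity) (Real.rpow_nonneg ?_ _)
    exact (lt_min (hg₁0 y i) (hg₂0 y i)).le

end Keyed

/-! ### Short descriptions with small lists -/

/-- Ranks are put into boxes: the residue modulo `K` selects one of `K` columns, and each column
is cut into dyadic segments. -/
def rankBox (K r : ℕ) : ℕ × ℕ := (Nat.log 2 (r / K + 1), r % K)

theorem finite_rankBox {K : ℕ} (hK : 0 < K) (r : ℕ) :
    {r' | rankBox K r' = rankBox K r}.Finite := by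
  refine (Set.finite_Iio (K * 2 ^ (Nat.log 2 (r / K + 1) + 1))).subset fun r' hr' => ?_
  have h1 : Nat.log 2 (r' / K + 1) = Nat.log 2 (r / K + 1) := congrArg Prod.fst hr'
  have h2 := Nat.lt_pow_succ_log_self one_lt_two (r' / K + 1)
  rw [h1] at h2
  rw [Set.mem_Iio, mul_comm, ← Nat.div_lt_iff_lt_mul hK]
  omega

/-- Within a column, the segment containing row `r / K` has at most `2 ^ j ≤ r / K + 1` rows, where
`j` is its dyadic index. In particular a rank below `K` is alone in its box. -/
theorem ncard_rankBox_le (K r : ℕ) : {r' | rankBox K r' = rankBox K r}.ncard ≤ r / K + 1 := by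
  have hne : r / K + 1 ≠ 0 := Nat.succ_ne_zero _
  set j := Nat.log 2 (r / K + 1) with hj
  have h : {r' | rankBox K r' = rankBox K r}.ncard ≤
      (Finset.Ico (2 ^ j) (2 ^ (j + 1)) : Set ℕ).ncard := by
    refine Set.ncard_le_ncard_of_injOn (fun r' => r' / K + 1) ?_ ?_ (Set.toFinite _)
    · intro r' hr'
      have h1 : Nat.log 2 (r' / K + 1) = j := congrArg Prod.fst hr'
      simp only [Finset.coe_Ico, Set.mem_Ico]
      rw [← h1]
      exact ⟨Nat.pow_log_le_self 2 (Nat.succ_ne_zero _),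
        Nat.lt_pow_succ_log_self one_lt_two _⟩
    · intro r₁ h₁ r₂ h₂ he
      have e₁ : r₁ % K = r % K := congrArg Prod.snd h₁
      have e₂ : r₂ % K = r % K := congrArg Prod.snd h₂
      have e : r₁ / K = r₂ / K := by simpa using he
      rw [← Nat.div_add_mod r₁ K, ← Nat.div_add_mod r₂ K, e, e₁, e₂]
  rw [Set.ncard_coe_finset, Nat.card_Ico, pow_succ] at h
  have := Nat.pow_log_le_self 2 hne
  rw [← hj] at this
  omega

section Existence

variable {A B M₁ M₂ : Type*} [Fintype A] [Fintype B] [Fintype M₁] [Fintype M₂]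

/-- A description of `x` by two indices for which the expected power of the number of `x'` with
the same description is close to `1`. -/
theorem exists_description (P : PMF (A × B)) {ρ : ℝ} (hρ : 0 < ρ) {K : ℕ} (hK : 0 < K) :
    ∃ h : A → B → Fin (Nat.log 2 (Fintype.card A) + 1) × Fin K,
      ∑ x, ∑ y, (P (x, y)).toReal * ({x' | h x' y = h x y}.ncard : ℝ) ^ ρ ≤
        1 + (2 / K) ^ ρ * renyiSum ρ P := by
  obtain ⟨G, hG⟩ := exists_guessing_le_renyiSum P hρ
  have hK' : (0 : ℝ) < K := Nat.cast_pos.2 hK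
  have hlog : ∀ x y, (rankBox K (G y x)).1 < Nat.log 2 (Fintype.card A) + 1 := fun x y =>
    Nat.lt_succ_of_le (Nat.log_mono_right (b := 2) (n := (G y x : ℕ) / K + 1)
      ((Nat.succ_le_succ (Nat.div_le_self _ _)).trans (G y x).isLt))
  let h : A → B → Fin (Nat.log 2 (Fintype.card A) + 1) × Fin K := fun x y =>
    (⟨(rankBox K (G y x)).1, hlog x y⟩, ⟨(rankBox K (G y x)).2, Nat.mod_lt _ hK⟩)
  have hterm : ∀ x y, ({x' | h x' y = h x y}.ncard : ℝ) ^ ρ ≤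
      1 + (2 / K) ^ ρ * (guessNumber (G y) x : ℝ) ^ ρ := by
    intro x y
    have hbox : ∀ x', h x' y = h x y → rankBox K (G y x') = rankBox K (G y x) := by
      intro x' hx'
      simpa [h, Prod.ext_iff, Fin.ext_iff] using hx'
    have hc : {x' | h x' y = h x y}.ncard ≤ (G y x : ℕ) / K + 1 := by
      refine le_trans ?_ (ncard_rankBox_le K (G y x))
      refine Set.ncard_le_ncard_of_injOn (fun x' => (G y x' : ℕ)) (fun x' hx' => hbox x' hx')
        (fun x₁ _ x₂ _ he => (G y).injective (Fin.ext he)) (finite_rankBox hK _)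
    -- Ranks below `K` account for the term `1`; for the others `r / K + 1 ≤ 2 * r / K`, which is
    -- where the constant `2` comes from.
    rcases lt_or_ge (G y x : ℕ) K with hlt | hge
    · rw [Nat.div_eq_of_lt hlt] at hc
      have h1 : ({x' | h x' y = h x y}.ncard : ℝ) ≤ 1 := by exact_mod_cast hc
      have h2 := Real.rpow_le_one (Nat.cast_nonneg _) h1 hρ.le
      have h3 : 0 ≤ (2 / K : ℝ) ^ ρ * (guessNumber (G y) x : ℝ) ^ ρ := by positivity
      linarith
    · rw [← Real.mul_rpow (by positivity) (Nat.cast_nonneg _)]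
      refine le_add_of_nonneg_of_le zero_le_one
        (Real.rpow_le_rpow (Nat.cast_nonneg _) ?_ hρ.le)
      rw [div_mul_eq_mul_div, le_div_iff₀ hK']
      have h1 := Nat.mul_le_mul_right K hc
      have h2 := Nat.div_mul_le_self (G y x : ℕ) K
      have h3 : {x' | h x' y = h x y}.ncard * K ≤ 2 * guessNumber (G y) x := by
        rw [guessNumber]
        linarith
      exact_mod_cast h3
  refine ⟨h, (Finset.sum_le_sum fun x _ => Finset.sum_le_sum fun y _ =>
    mul_le_mul_of_nonneg_left (hterm x y) ENNReal.toReal_nonneg).trans ?_⟩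
  have hK0 : 0 ≤ (2 / K : ℝ) ^ ρ := by positivity
  simp only [mul_add, mul_one, Finset.sum_add_distrib, sum_toReal_prod]
  have := mul_le_mul_of_nonneg_left hG hK0
  simp only [Finset.mul_sum] at this
  refine add_le_add le_rfl (le_trans (le_of_eq ?_) this)
  exact Finset.sum_congr rfl fun x _ => Finset.sum_congr rfl fun y _ => by ring

theorem exists_encoder (P : PMF (A × B)) {ρ : ℝ} (hρ : 0 < ρ) {s c₁ c₂ K : ℕ} (hs : 0 < s)
    (hK : 0 < K) (h₁ : s * c₁ ≤ Fintype.card M₁) (h₂ : s * c₂ ≤ Fintype.card M₂)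
    (hc : (Nat.log 2 (Fintype.card A) + 1) * K ≤ s * (c₁ * c₂)) :
    ∃ enc : Encoder A B M₁ M₂,
      bobListAmbiguity ρ P enc ≤ 1 + (2 / K) ^ ρ * renyiSum ρ P ∧
      renyiSum ρ P ≤ eveAmbiguity ρ P enc *
        ((c₁ + c₂ : ℝ) * (harmonic (Fintype.card A) : ℝ)) ^ ρ := by
  obtain ⟨h, hh⟩ := exists_description P hρ hK
  have : NeZero s := ⟨hs.ne'⟩
  obtain ⟨e⟩ : Nonempty (Fin (Nat.log 2 (Fintype.card A) + 1) × Fin K ↪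
      Fin s × Fin c₁ × Fin c₂) :=
    Function.Embedding.nonempty_of_card_le (by simpa using hc)
  obtain ⟨i₁⟩ : Nonempty (Fin s × Fin c₁ ↪ M₁) :=
    Function.Embedding.nonempty_of_card_le (by simpa using h₁)
  obtain ⟨i₂⟩ : Nonempty (Fin s × Fin c₂ ↪ M₂) :=
    Function.Embedding.nonempty_of_card_le (by simpa using h₂)
  refine ⟨keyedEncoder (fun x y => e (h x y)) i₁ i₂, ?_, ?_⟩
  · refine (bobListAmbiguity_keyedEncoder_le P _ i₁ i₂ hρ.le).trans ?_
    simpa only [e.injective.eq_iff] using hh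
  · simpa using renyiSum_le_eveAmbiguity_keyedEncoder_mul P (fun x y => e (h x y)) i₁ i₂ hρ

end Existence

/-! ### Exponential growth rates -/

theorem eventually_linear_le_two_rpow (a b : ℝ) {δ : ℝ} (hδ : 0 < δ) :
    ∀ᶠ n : ℕ in atTop, a + b * n ≤ (2 : ℝ) ^ ((n : ℝ) * δ) := by
  have hr : (1 : ℝ) < 2 ^ δ := Real.one_lt_rpow one_lt_two hδ
  have h := (isLittleO_pow_const_const_pow_of_one_lt (R := ℝ) 1 hr).bound
    (c := 1 / (|a| + |b| + 1)) (by positivity)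
  filter_upwards [h, eventually_ge_atTop 1] with n hn h1
  have h1' : (1 : ℝ) ≤ n := by exact_mod_cast h1
  rw [pow_one, Real.norm_of_nonneg (Nat.cast_nonneg _), Real.norm_of_nonneg (by positivity),
    one_div, inv_mul_eq_div, le_div_iff₀ (by positivity)] at hn
  rw [mul_comm (n : ℝ) δ, Real.rpow_mul two_pos.le, Real.rpow_natCast]
  refine le_trans ?_ hn
  nlinarith [le_abs_self a, le_abs_self b, abs_nonneg a, abs_nonneg b]

theorem half_le_natFloor {x : ℝ} (hx : 1 ≤ x) : x / 2 ≤ (⌊x⌋₊ : ℝ) := by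
  have h1 := Nat.lt_floor_add_one x
  have h2 : (1 : ℝ) ≤ ⌊x⌋₊ := by exact_mod_cast Nat.one_le_floor_iff _ |>.2 hx
  linarith

theorem one_le_two_rpow {t : ℝ} (ht : 0 ≤ t) : (1 : ℝ) ≤ 2 ^ t :=
  Real.one_le_rpow one_le_two ht

theorem two_rpow_le {s t : ℝ} (h : s ≤ t) : (2 : ℝ) ^ s ≤ 2 ^ t :=
  Real.rpow_le_rpow_of_exponent_le one_le_two h

theorem liminf_logb_div_le {u : ℕ → ℝ} {c : ℝ} (hu : ∀ n, 0 < u n)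
    (h : ∀ᶠ n : ℕ in atTop, u n ≤ (2 : ℝ) ^ ((n : ℝ) * c)) :
    liminf (fun n : ℕ => ((Real.logb 2 (u n) / n : ℝ) : EReal)) atTop ≤ (c : EReal) := by
  refine (liminf_le_limsup (by isBoundedDefault) (by isBoundedDefault)).trans (limsup_le_of_le (by isBoundedDefault) ?_)
  filter_upwards [h, eventually_gt_atTop 0] with n hn h0
  rw [EReal.coe_le_coe_iff, div_le_iff₀ (Nat.cast_pos.2 h0),
    Real.logb_le_iff_le_rpow one_lt_two (hu n), mul_comm c]
  exact hn

theorem le_liminf_logb_div {u : ℕ → ℝ} {c : ℝ} (hu : ∀ n, 0 < u n)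
    (h : ∀ᶠ n : ℕ in atTop, (2 : ℝ) ^ ((n : ℝ) * c) ≤ u n) :
    (c : EReal) ≤ liminf (fun n : ℕ => ((Real.logb 2 (u n) / n : ℝ) : EReal)) atTop := by
  refine le_liminf_of_le (by isBoundedDefault) ?_
  filter_upwards [h, eventually_gt_atTop 0] with n hn h0
  rw [EReal.coe_le_coe_iff, le_div_iff₀ (Nat.cast_pos.2 h0),
    Real.le_logb_iff_rpow_le one_lt_two (hu n), mul_comm c]
  exact hn

theorem bobGuessAmbiguity_le_bobAmbiguity {A B M₁ M₂ : Type*} [Fintype A] [Fintype B]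
    [Fintype M₁] [Fintype M₂] (v : Version) {ρ : ℝ} (hρ : 0 ≤ ρ) (P : PMF (A × B))
    (enc : Encoder A B M₁ M₂) : bobGuessAmbiguity ρ P enc ≤ bobAmbiguity v ρ P enc := by
  cases v
  · exact le_rfl
  · exact bobGuessAmbiguity_le_bobListAmbiguity P enc hρ

theorem bobAmbiguity_le_bobListAmbiguity {A B M₁ M₂ : Type*} [Fintype A] [Fintype B]
    [Fintype M₁] [Fintype M₂] (v : Version) {ρ : ℝ} (hρ : 0 ≤ ρ) (P : PMF (A × B))
    (enc : Encoder A B M₁ M₂) : bobAmbiguity v ρ P enc ≤ bobListAmbiguity ρ P enc := by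
  cases v
  · exact bobGuessAmbiguity_le_bobListAmbiguity P enc hρ
  · exact le_rfl

theorem card_hintSet_le (R : ℝ) (n : ℕ) :
    (Fintype.card (HintSet R n) : ℝ) ≤ 2 ^ ((n : ℝ) * R) := by
  rw [Fintype.card_fin]
  exact Nat.floor_le (by positivity)

/-! ### Converse and achievability for the exponents -/

section Asymptotic

variable {𝒳 𝒴 : Type*} [Fintype 𝒳] [Fintype 𝒴]
  {P : (n : ℕ) → PMF ((Fin n → 𝒳) × (Fin n → 𝒴))} {ρ H R₁ R₂ : ℝ}

theorem eventually_renyiSum_le (hρ : 0 < ρ) (hH : IsCondRenyiEntropyRate (1 / (1 + ρ)) P H)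
    {δ : ℝ} (hδ : 0 < δ) :
    ∀ᶠ n : ℕ in atTop, renyiSum ρ (P n) ≤ 2 ^ ((n : ℝ) * (ρ * (H + δ))) := by
  filter_upwards [hH.eventually_le_const (lt_add_of_pos_right H hδ), eventually_gt_atTop 0]
    with n hn h0
  rw [← Real.logb_le_iff_le_rpow one_lt_two (zero_lt_one.trans_le (one_le_renyiSum (P n) hρ)),
    logb_renyiSum (P n) hρ, mul_left_comm, mul_comm (n : ℝ)]
  rw [div_le_iff₀ (Nat.cast_pos.2 h0)] at hn
  exact mul_le_mul_of_nonneg_left hn hρ.le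

theorem eventually_le_renyiSum (hρ : 0 < ρ) (hH : IsCondRenyiEntropyRate (1 / (1 + ρ)) P H)
    {δ : ℝ} (hδ : 0 < δ) :
    ∀ᶠ n : ℕ in atTop, 2 ^ ((n : ℝ) * (ρ * (H - δ))) ≤ renyiSum ρ (P n) := by
  filter_upwards [hH.eventually_const_le (sub_lt_self H hδ), eventually_gt_atTop 0]
    with n hn h0
  rw [← Real.le_logb_iff_rpow_le one_lt_two (zero_lt_one.trans_le (one_le_renyiSum (P n) hρ)),
    logb_renyiSum (P n) hρ, mul_left_comm, mul_comm (n : ℝ)]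
  rw [le_div_iff₀ (Nat.cast_pos.2 h0)] at hn
  exact mul_le_mul_of_nonneg_left hn hρ.le

theorem condRenyiEntropyRate_nonneg (hρ : 0 < ρ)
    (hH : IsCondRenyiEntropyRate (1 / (1 + ρ)) P H) : 0 ≤ H := by
  refine ge_of_tendsto' hH fun n => div_nonneg ?_ (Nat.cast_nonneg _)
  have h := Real.logb_nonneg one_lt_two (one_le_renyiSum (P n) hρ)
  rw [logb_renyiSum (P n) hρ] at h
  exact nonneg_of_mul_nonneg_right h hρ

/-- The harmonic number of `|𝒳| ^ n` is at most `1 + n * log |𝒳|`, hence subexponential. -/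
theorem eventually_const_mul_harmonic_le (c : ℝ) (hc : 0 ≤ c) {δ : ℝ} (hδ : 0 < δ) :
    ∀ᶠ n : ℕ in atTop, c * (harmonic (Fintype.card (Fin n → 𝒳)) : ℝ) ≤ 2 ^ ((n : ℝ) * δ) := by
  filter_upwards [eventually_linear_le_two_rpow c (c * Real.log (Fintype.card 𝒳)) hδ] with n hn
  refine le_trans ?_ hn
  have h := harmonic_le_one_add_log (Fintype.card (Fin n → 𝒳))
  rw [Fintype.card_fun, Fintype.card_fin, Nat.cast_pow, Real.log_pow] at h
  rw [Fintype.card_fun, Fintype.card_fin]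
  calc _ ≤ c * (1 + n * Real.log (Fintype.card 𝒳)) := mul_le_mul_of_nonneg_left h hc
    _ = _ := by ring

variable {enc : (n : ℕ) → Encoder (Fin n → 𝒳) (Fin n → 𝒴) (HintSet R₁ n) (HintSet R₂ n)}

theorem le_add_of_bobGuessAmbiguity_le (hρ : 0 < ρ)
    (hH : IsCondRenyiEntropyRate (1 / (1 + ρ)) P H)
    (hbob : ∀ᶠ n in atTop, bobGuessAmbiguity ρ (P n) (enc n) ≤ 2) : H ≤ R₁ + R₂ := by
  by_contra! hlt
  -- One `δ` pays for the limit defining `H`, one for the harmonic factor, and the last gives `2 ^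
  -- (n * (ρ * δ)) ≥ 3`, against Bob's bound `2`.
  obtain ⟨δ, hδ, hδH⟩ : ∃ δ > 0, R₁ + R₂ + 3 * δ = H :=
    ⟨(H - (R₁ + R₂)) / 3, by linarith, by ring⟩
  have hev := (eventually_le_renyiSum hρ hH hδ).and (hbob.and
    ((eventually_const_mul_harmonic_le (𝒳 := 𝒳) 1 zero_le_one hδ).and
      (eventually_linear_le_two_rpow 3 0 (mul_pos hρ hδ))))
  obtain ⟨n, h1, h2, h3, h4⟩ := hev.exists
  rw [one_mul] at h3
  rw [zero_mul, add_zero] at h4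
  have hh := harmonic_cast_nonneg (Fintype.card (Fin n → 𝒳))
  have hprod : (Fintype.card (HintSet R₁ n) * Fintype.card (HintSet R₂ n) : ℝ) *
      (harmonic (Fintype.card (Fin n → 𝒳)) : ℝ) ≤ 2 ^ ((n : ℝ) * (R₁ + R₂ + δ)) := by
    have e : (2 : ℝ) ^ ((n : ℝ) * (R₁ + R₂ + δ)) =
        2 ^ ((n : ℝ) * R₁) * 2 ^ ((n : ℝ) * R₂) * 2 ^ ((n : ℝ) * δ) := by
      rw [← Real.rpow_add two_pos, ← Real.rpow_add two_pos]
      ring_nf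
    rw [e]
    exact mul_le_mul (mul_le_mul (card_hintSet_le _ _) (card_hintSet_le _ _) (Nat.cast_nonneg _)
      (by positivity)) h3 hh (by positivity)
  have hT := h1.trans (renyiSum_le_bobGuessAmbiguity_mul (P n) (enc n) hρ)
  have hT' := hT.trans (mul_le_mul h2 (Real.rpow_le_rpow (by positivity) hprod hρ.le)
    (by positivity) two_pos.le)
  rw [← Real.rpow_mul two_pos.le] at hT'
  have e : (2 : ℝ) ^ ((n : ℝ) * (ρ * (H - δ))) =
      2 ^ ((n : ℝ) * (ρ * δ)) * 2 ^ ((n : ℝ) * (R₁ + R₂ + δ) * ρ) := by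
    rw [← Real.rpow_add two_pos, ← hδH]
    ring_nf
  rw [e] at hT'
  have := le_of_mul_le_mul_right hT' (by positivity)
  linarith

theorem eventually_bobGuessAmbiguity_le_two {v : Version} (hρ : 0 < ρ)
    (h : Tendsto (fun n : ℕ => bobAmbiguity v ρ (P n) (enc n)) atTop (𝓝 1)) :
    ∀ᶠ n in atTop, bobGuessAmbiguity ρ (P n) (enc n) ≤ 2 := by
  filter_upwards [h.eventually_le_const one_lt_two] with n hn
  exact (bobGuessAmbiguity_le_bobAmbiguity v hρ.le _ _).trans hn

theorem eventually_eveAmbiguity_le {R : ℝ} (hρ : 0 < ρ)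
    (hbob : ∀ᶠ n in atTop, bobGuessAmbiguity ρ (P n) (enc n) ≤ 2)
    (heve : ∀ n, eveAmbiguity ρ (P n) (enc n) ≤
      (Fintype.card (HintSet R n) : ℝ) ^ ρ * bobGuessAmbiguity ρ (P n) (enc n))
    {δ : ℝ} (hδ : 0 < δ) :
    ∀ᶠ n : ℕ in atTop, eveAmbiguity ρ (P n) (enc n) ≤ 2 ^ ((n : ℝ) * (ρ * (R + δ))) := by
  filter_upwards [hbob, eventually_linear_le_two_rpow 2 0 (mul_pos hρ hδ)] with n h1 h2
  rw [zero_mul, add_zero] at h2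
  have e : (2 : ℝ) ^ ((n : ℝ) * (ρ * (R + δ))) =
      (2 ^ ((n : ℝ) * R)) ^ ρ * 2 ^ ((n : ℝ) * (ρ * δ)) := by
    rw [← Real.rpow_mul two_pos.le, ← Real.rpow_add two_pos]
    ring_nf
  rw [e]
  refine (heve n).trans (mul_le_mul (Real.rpow_le_rpow (Nat.cast_nonneg _)
    (card_hintSet_le R n) hρ.le) (h1.trans h2) ?_ (by positivity))
  exact zero_le_one.trans (one_le_bobGuessAmbiguity _ _ hρ.le)

theorem IsAchievable.le {v : Version} (hρ : 0 < ρ)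
    (hH : IsCondRenyiEntropyRate (1 / (1 + ρ)) P H) {E : ℝ} (hE : IsAchievable v ρ R₁ R₂ P E) :
    E ≤ ρ * min (min R₁ R₂) H := by
  obtain ⟨enc, hbob, hliminf⟩ := hE
  have hbob' := eventually_bobGuessAmbiguity_le_two hρ hbob
  have hpos : ∀ n, 0 < eveAmbiguity ρ (P n) (enc n) := fun n =>
    zero_lt_one.trans_le (one_le_eveAmbiguity _ _ hρ.le)
  have hbound : ∀ c : ℝ, (∀ δ > 0, ∀ᶠ n : ℕ in atTop, eveAmbiguity ρ (P n) (enc n) ≤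
      2 ^ ((n : ℝ) * (ρ * (c + δ)))) → E / ρ ≤ c := by
    intro c hc
    refine le_of_forall_pos_le_add fun δ hδ => ?_
    rw [div_le_iff₀ hρ, mul_comm]
    exact EReal.coe_le_coe_iff.1 (hliminf.trans (liminf_logb_div_le hpos (hc δ hδ)))
  rw [mul_comm, ← div_le_iff₀ hρ]
  refine le_min (le_min (hbound R₁ fun δ hδ => ?_) (hbound R₂ fun δ hδ => ?_))
    (hbound H fun δ hδ => ?_)
  · exact eventually_eveAmbiguity_le hρ hbob'
      (fun n => eveAmbiguity_le_left (P n) (enc n) hρ.le) hδ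
  · exact eventually_eveAmbiguity_le hρ hbob'
      (fun n => eveAmbiguity_le_right (P n) (enc n) hρ.le) hδ
  · filter_upwards [eventually_renyiSum_le hρ hH hδ] with n hn
    exact (eveAmbiguity_le_renyiSum (P n) (enc n) hρ).trans hn

theorem IsAchievable.le_add {v : Version} (hρ : 0 < ρ)
    (hH : IsCondRenyiEntropyRate (1 / (1 + ρ)) P H) {E : ℝ} (hE : IsAchievable v ρ R₁ R₂ P E) :
    H ≤ R₁ + R₂ := by
  obtain ⟨enc, hbob, -⟩ := hE
  exact le_add_of_bobGuessAmbiguity_le hρ hH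
    (eventually_bobGuessAmbiguity_le_two hρ hbob)

theorem log_card_fun_le (n : ℕ) :
    Nat.log 2 (Fintype.card (Fin n → 𝒳)) ≤ Fintype.card 𝒳 * n := by
  rw [Fintype.card_fun, Fintype.card_fin]
  refine (Nat.log_mono_right (Nat.pow_le_pow_left Nat.lt_two_pow_self.le n)).trans_eq ?_
  rw [← pow_mul, Nat.log_pow one_lt_two]

theorem floor_two_rpow_mul_le {n : ℕ} {a b R : ℝ} (h : a + b ≤ R) :
    ⌊(2 : ℝ) ^ ((n : ℝ) * a)⌋₊ * ⌊(2 : ℝ) ^ ((n : ℝ) * b)⌋₊ ≤ Fintype.card (HintSet R n) := by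
  rw [Fintype.card_fin]
  refine Nat.le_floor ?_
  push_cast
  calc (⌊(2 : ℝ) ^ ((n : ℝ) * a)⌋₊ : ℝ) * ⌊(2 : ℝ) ^ ((n : ℝ) * b)⌋₊
      ≤ 2 ^ ((n : ℝ) * a) * 2 ^ ((n : ℝ) * b) :=
        mul_le_mul (Nat.floor_le (by positivity)) (Nat.floor_le (by positivity))
          (Nat.cast_nonneg _) (by positivity)
    _ = 2 ^ ((n : ℝ) * (a + b)) := by rw [← Real.rpow_add two_pos, mul_add]
    _ ≤ _ := two_rpow_le (mul_le_mul_of_nonneg_left h (Nat.cast_nonneg _))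

/-- Splitting a total rate `h` into a padded part `s` common to both hints and private parts
`a₁`, `a₂`. -/
theorem exists_rate_split {h : ℝ} (hh : 0 ≤ h) (hR₁ : 0 ≤ R₁) (hR₂ : 0 ≤ R₂)
    (hlt : h ≤ R₁ + R₂) :
    ∃ s a₁ a₂ : ℝ, 0 ≤ s ∧ 0 ≤ a₁ ∧ 0 ≤ a₂ ∧ s + a₁ ≤ R₁ ∧ s + a₂ ≤ R₂ ∧ s + a₁ + a₂ = h ∧
      a₁ ≤ h - min (min R₁ R₂) h ∧ a₂ ≤ h - min (min R₁ R₂) h := by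
  -- What the second hint cannot hold must be private to the first, and vice versa; thus `s + a₂ =
  -- min h R₂` and `s + a₁ = min h R₁`.
  refine ⟨h - max 0 (h - R₂) - max 0 (h - R₁), max 0 (h - R₂), max 0 (h - R₁), ?_⟩
  rcases le_total 0 (h - R₁) with h1 | h1 <;> rcases le_total 0 (h - R₂) with h2 | h2 <;>
    simp only [max_eq_left, max_eq_right, h1, h2] <;>
    refine ⟨?_, ?_, ?_, ?_, ?_, ?_, ?_, ?_⟩ <;>
    first
      | trivial
      | linarith
      | linarith [min_le_left (min R₁ R₂) h, min_le_right (min R₁ R₂) h, min_le_left R₁ R₂,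
          min_le_right R₁ R₂]

theorem eventually_exists_encoder (hρ : 0 < ρ) (hH : IsCondRenyiEntropyRate (1 / (1 + ρ)) P H)
    (hR₁ : 0 < R₁) (hR₂ : 0 < R₂) {ε : ℝ} (hε : 0 < ε) (hlt : H + 4 * ε ≤ R₁ + R₂) :
    ∀ᶠ n : ℕ in atTop,
      ∃ enc : Encoder (Fin n → 𝒳) (Fin n → 𝒴) (HintSet R₁ n) (HintSet R₂ n),
        bobListAmbiguity ρ (P n) enc ≤ 1 + 2 ^ ρ * (2 ^ (-(ρ * ε))) ^ n ∧
        2 ^ ((n : ℝ) * (ρ * (min (min R₁ R₂) H - 6 * ε))) ≤ eveAmbiguity ρ (P n) enc := by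
  have hH0 := condRenyiEntropyRate_nonneg hρ hH
  obtain ⟨s, a₁, a₂, hs, ha₁, ha₂, hs₁, hs₂, hsum, hm₁, hm₂⟩ :=
    -- Of the rate `H + 4 * ε`, the columns take `H + 3 * ε` and the dyadic segments, only linearly
    -- many in `n`, take `ε`.
    exists_rate_split (h := H + 4 * ε) (by linarith) hR₁.le hR₂.le hlt
  set m := min (min R₁ R₂) (H + 4 * ε) with hm
  have hmm : min (min R₁ R₂) H ≤ m := min_le_min le_rfl (by linarith)
  filter_upwards [eventually_renyiSum_le hρ hH (show 0 < 2 * ε by linarith),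
    eventually_le_renyiSum hρ hH hε,
    eventually_const_mul_harmonic_le (𝒳 := 𝒳) 2 two_pos.le hε,
    -- The `16` absorbs all rounding: a factor `2` for the ceiling in `K` and `2` for each of the
    -- three floors.
    eventually_linear_le_two_rpow 16 (16 * Fintype.card 𝒳) hε] with n hT₁ hT₂ hharm hlin
  have hn : (0 : ℝ) ≤ n := Nat.cast_nonneg _
  set K := ⌈(2 : ℝ) ^ ((n : ℝ) * (H + 3 * ε))⌉₊ with hK
  have hKle : (2 : ℝ) ^ ((n : ℝ) * (H + 3 * ε)) ≤ K := Nat.le_ceil _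
  have hKpos : 0 < K := Nat.ceil_pos.2 (by positivity)
  have hK2 : (K : ℝ) ≤ 2 * 2 ^ ((n : ℝ) * (H + 3 * ε)) := by
    have h1 := Nat.ceil_lt_add_one (a := (2 : ℝ) ^ ((n : ℝ) * (H + 3 * ε))) (by positivity)
    have h2 := one_le_two_rpow (t := (n : ℝ) * (H + 3 * ε)) (by positivity)
    linarith
  have hfl : ∀ a : ℝ, 0 ≤ a → (2 : ℝ) ^ ((n : ℝ) * a) / 2 ≤ ⌊(2 : ℝ) ^ ((n : ℝ) * a)⌋₊ :=
    fun a ha => half_le_natFloor (one_le_two_rpow (by positivity))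
  have hcard : (Nat.log 2 (Fintype.card (Fin n → 𝒳)) + 1) * K ≤
      ⌊(2 : ℝ) ^ ((n : ℝ) * s)⌋₊ *
        (⌊(2 : ℝ) ^ ((n : ℝ) * a₁)⌋₊ * ⌊(2 : ℝ) ^ ((n : ℝ) * a₂)⌋₊) := by
    rw [← Nat.cast_le (α := ℝ)]
    push_cast
    have hlog : (Nat.log 2 (Fintype.card (Fin n → 𝒳)) : ℝ) ≤ Fintype.card 𝒳 * n := by
      exact_mod_cast log_card_fun_le (𝒳 := 𝒳) n
    have e : (2 : ℝ) ^ ((n : ℝ) * ε) * 2 ^ ((n : ℝ) * (H + 3 * ε)) =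
        2 ^ ((n : ℝ) * s) * (2 ^ ((n : ℝ) * a₁) * 2 ^ ((n : ℝ) * a₂)) := by
      rw [← Real.rpow_add two_pos, ← Real.rpow_add two_pos, ← Real.rpow_add two_pos]
      congr 1
      linear_combination (-(n : ℝ)) * hsum
    calc ((Nat.log 2 (Fintype.card (Fin n → 𝒳)) : ℝ) + 1) * K
        ≤ ((2 : ℝ) ^ ((n : ℝ) * ε) / 16) * (2 * 2 ^ ((n : ℝ) * (H + 3 * ε))) := by
          gcongr
          linarith
      _ = (2 ^ ((n : ℝ) * s) / 2) * ((2 ^ ((n : ℝ) * a₁) / 2) * (2 ^ ((n : ℝ) * a₂) / 2)) := by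
          linear_combination (1 / 8 : ℝ) * e
      _ ≤ _ := by
          gcongr
          exacts [hfl s hs, hfl a₁ ha₁, hfl a₂ ha₂]
  obtain ⟨enc, hbob, heve⟩ := exists_encoder (P n) hρ
    (Nat.floor_pos.2 (one_le_two_rpow (mul_nonneg hn hs))) hKpos
    (floor_two_rpow_mul_le hs₁) (floor_two_rpow_mul_le hs₂) hcard
  refine ⟨enc, hbob.trans (add_le_add le_rfl ?_), ?_⟩
  · calc (2 / K : ℝ) ^ ρ * renyiSum ρ (P n)
        ≤ (2 / 2 ^ ((n : ℝ) * (H + 3 * ε))) ^ ρ * 2 ^ ((n : ℝ) * (ρ * (H + 2 * ε))) := by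
          have := zero_le_one.trans (one_le_renyiSum (P n) hρ)
          gcongr
      _ = 2 ^ ρ * (2 ^ (-(ρ * ε))) ^ n := by
          rw [Real.div_rpow two_pos.le (by positivity), ← Real.rpow_mul two_pos.le,
            div_eq_mul_inv, ← Real.rpow_neg two_pos.le, mul_assoc, ← Real.rpow_add two_pos,
            ← Real.rpow_natCast, ← Real.rpow_mul two_pos.le]
          ring_nf
  -- The total loss is `6 * ε`: `4 * ε` from the description rate, `ε` from the harmonic factor
  -- (with the sum of two floors) and `ε` from the lower bound on `renyiSum`.
  · have hc : ((⌊(2 : ℝ) ^ ((n : ℝ) * a₁)⌋₊ : ℝ) + ⌊(2 : ℝ) ^ ((n : ℝ) * a₂)⌋₊) *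
        (harmonic (Fintype.card (Fin n → 𝒳)) : ℝ) ≤ 2 ^ ((n : ℝ) * (H + 5 * ε - m)) := by
      have hh := harmonic_cast_nonneg (Fintype.card (Fin n → 𝒳))
      have hf : ∀ a : ℝ, a ≤ H + 4 * ε - m →
          (⌊(2 : ℝ) ^ ((n : ℝ) * a)⌋₊ : ℝ) ≤ 2 ^ ((n : ℝ) * (H + 4 * ε - m)) := fun a ha =>
        (Nat.floor_le (by positivity)).trans
          (two_rpow_le (mul_le_mul_of_nonneg_left ha hn))
      calc _ ≤ ((2 : ℝ) ^ ((n : ℝ) * (H + 4 * ε - m)) + 2 ^ ((n : ℝ) * (H + 4 * ε - m))) *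
            (harmonic (Fintype.card (Fin n → 𝒳)) : ℝ) := by
            gcongr
            exacts [hf a₁ hm₁, hf a₂ hm₂]
        _ = 2 ^ ((n : ℝ) * (H + 4 * ε - m)) *
            (2 * (harmonic (Fintype.card (Fin n → 𝒳)) : ℝ)) := by ring
        _ ≤ 2 ^ ((n : ℝ) * (H + 4 * ε - m)) * 2 ^ ((n : ℝ) * ε) := by gcongr
        _ = _ := by
            rw [← Real.rpow_add two_pos]
            ring_nf
    have he0 := zero_le_one.trans (one_le_eveAmbiguity (P n) enc hρ.le)
    have hh := harmonic_cast_nonneg (Fintype.card (Fin n → 𝒳))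
    have h1 := (hT₂.trans heve).trans (mul_le_mul_of_nonneg_left
      (Real.rpow_le_rpow (by positivity) hc hρ.le) he0)
    rw [← Real.rpow_mul two_pos.le, ← div_le_iff₀ (by positivity), ← Real.rpow_sub two_pos] at h1
    refine (two_rpow_le ?_).trans h1
    have h2 : (n : ℝ) * (ρ * (min (min R₁ R₂) H - 6 * ε)) ≤ (n : ℝ) * (ρ * (m - 6 * ε)) := by
      gcongr
    refine h2.trans_eq ?_
    ring

theorem hintSet_nonempty {R : ℝ} (hR : 0 ≤ R) (n : ℕ) : Nonempty (HintSet R n) :=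
  ⟨⟨0, Nat.floor_pos.2 (one_le_two_rpow (by positivity))⟩⟩

theorem isAchievable_of_lt (v : Version) (hρ : 0 < ρ)
    (hH : IsCondRenyiEntropyRate (1 / (1 + ρ)) P H) (hR₁ : 0 < R₁) (hR₂ : 0 < R₂)
    (hlt : H < R₁ + R₂) {E : ℝ} (hE : E < ρ * min (min R₁ R₂) H) :
    IsAchievable v ρ R₁ R₂ P E := by
  set m := min (min R₁ R₂) H
  have hE' : E / ρ < m := by rwa [div_lt_iff₀ hρ, mul_comm]
  set ε := min ((m - E / ρ) / 6) ((R₁ + R₂ - H) / 4) with hεdef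
  have hε : 0 < ε := lt_min (by linarith) (by linarith)
  have hε₁ : ε ≤ (m - E / ρ) / 6 := min_le_left _ _
  have hε₂ : ε ≤ (R₁ + R₂ - H) / 4 := min_le_right _ _
  have hev := eventually_exists_encoder hρ hH hR₁ hR₂ hε (by linarith)
  -- Good encoders exist for all large `n`; elsewhere an arbitrary encoder is used, and one exists
  -- because the hint sets are nonempty.
  have hchoice : ∀ n : ℕ,
      ∃ enc : Encoder (Fin n → 𝒳) (Fin n → 𝒴) (HintSet R₁ n) (HintSet R₂ n),
      (∃ enc' : Encoder (Fin n → 𝒳) (Fin n → 𝒴) (HintSet R₁ n) (HintSet R₂ n),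
        bobListAmbiguity ρ (P n) enc' ≤ 1 + 2 ^ ρ * (2 ^ (-(ρ * ε))) ^ n ∧
        2 ^ ((n : ℝ) * (ρ * (m - 6 * ε))) ≤ eveAmbiguity ρ (P n) enc') →
      bobListAmbiguity ρ (P n) enc ≤ 1 + 2 ^ ρ * (2 ^ (-(ρ * ε))) ^ n ∧
        2 ^ ((n : ℝ) * (ρ * (m - 6 * ε))) ≤ eveAmbiguity ρ (P n) enc := by
    intro n
    have := hintSet_nonempty hR₁.le n
    have := hintSet_nonempty hR₂.le n
    have : Nonempty (Encoder (Fin n → 𝒳) (Fin n → 𝒴) (HintSet R₁ n) (HintSet R₂ n)) :=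
      ⟨fun _ _ => PMF.pure (Classical.arbitrary _)⟩
    by_cases h : ∃ enc' : Encoder (Fin n → 𝒳) (Fin n → 𝒴) (HintSet R₁ n) (HintSet R₂ n),
        bobListAmbiguity ρ (P n) enc' ≤ 1 + 2 ^ ρ * (2 ^ (-(ρ * ε))) ^ n ∧
        2 ^ ((n : ℝ) * (ρ * (m - 6 * ε))) ≤ eveAmbiguity ρ (P n) enc'
    · exact h.imp fun _ he _ => he
    · exact ⟨Classical.arbitrary _, fun he => absurd he h⟩
  choose enc henc using hchoice
  have henc' := hev.mono fun n hn => henc n hn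
  refine ⟨enc, ?_, ?_⟩
  · have hlim : Tendsto (fun n : ℕ => 1 + (2 : ℝ) ^ ρ * (2 ^ (-(ρ * ε))) ^ n) atTop (𝓝 1) := by
      have h0 : Tendsto (fun n : ℕ => ((2 : ℝ) ^ (-(ρ * ε))) ^ n) atTop (𝓝 0) :=
        tendsto_pow_atTop_nhds_zero_of_lt_one (by positivity)
          (Real.rpow_lt_one_of_one_lt_of_neg one_lt_two (neg_lt_zero.2 (mul_pos hρ hε)))
      simpa using (h0.const_mul ((2 : ℝ) ^ ρ)).const_add 1
    refine tendsto_of_tendsto_of_tendsto_of_le_of_le' tendsto_const_nhds hlim ?_ ?_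
    · exact Eventually.of_forall fun n => (one_le_bobGuessAmbiguity (P n) (enc n) hρ.le).trans
        (bobGuessAmbiguity_le_bobAmbiguity v hρ.le _ _)
    · exact henc'.mono fun n hn => (bobAmbiguity_le_bobListAmbiguity v hρ.le _ _).trans hn.1
  · have hEle : E ≤ ρ * (m - 6 * ε) := by
      rw [mul_comm, ← div_le_iff₀ hρ]
      linarith
    refine (EReal.coe_le_coe_iff.2 hEle).trans (le_liminf_logb_div (fun n =>
      zero_lt_one.trans_le (one_le_eveAmbiguity _ _ hρ.le)) (henc'.mono fun n hn => hn.2))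

theorem privacyExponent_eq (v : Version) (hρ : 0 < ρ)
    (hH : IsCondRenyiEntropyRate (1 / (1 + ρ)) P H) (hR₁ : 0 < R₁) (hR₂ : 0 < R₂)
    (hlt : H < R₁ + R₂) :
    privacyExponent v ρ R₁ R₂ P = ((ρ * min (min R₁ R₂) H : ℝ) : EReal) := by
  -- The supremum need not be attained: it suffices that every smaller real is achievable.
  refine le_antisymm (sSup_le ?_) (EReal.ge_of_forall_gt_iff_ge.1 fun E hE => le_sSup
    ⟨E, isAchievable_of_lt v hρ hH hR₁ hR₂ hlt (EReal.coe_lt_coe_iff.1 hE), rfl⟩)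
  rintro _ ⟨E, hE, rfl⟩
  exact EReal.coe_le_coe_iff.2 (hE.le hρ hH)

theorem privacyExponent_eq_bot (v : Version) (hρ : 0 < ρ)
    (hH : IsCondRenyiEntropyRate (1 / (1 + ρ)) P H) (hlt : R₁ + R₂ < H) :
    privacyExponent v ρ R₁ R₂ P = ⊥ := by
  refine sSup_eq_bot.2 ?_
  rintro _ ⟨E, hE, rfl⟩
  exact absurd (hE.le_add hρ hH) (not_le.2 hlt)

end Asymptotic

end

end DistStorage

theorem corollary1 {Ω 𝒳 𝒴 : Type*} [MeasurableSpace Ω] (μ : Measure Ω) [IsProbabilityMeasure μ]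
    [Fintype 𝒳] [MeasurableSpace 𝒳] [MeasurableSingletonClass 𝒳]
    [Fintype 𝒴] [MeasurableSpace 𝒴] [MeasurableSingletonClass 𝒴]
    (X : ℕ → Ω → 𝒳) (Y : ℕ → Ω → 𝒴) (hX : ∀ i, Measurable (X i)) (hY : ∀ i, Measurable (Y i))
    (ρ : ℝ) (hρ : 0 < ρ) (H : ℝ)
    (hH : DistStorage.IsCondRenyiEntropyRate (1 / (1 + ρ))
      (DistStorage.blockPMF μ X Y hX hY) H)
    (R₁ R₂ : ℝ) (hR₁ : 0 < R₁) (hR₂ : 0 < R₂) (v : DistStorage.Version) :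
    (H < R₁ + R₂ →
      DistStorage.privacyExponent v ρ R₁ R₂ (DistStorage.blockPMF μ X Y hX hY) =
        ((ρ * min (min R₁ R₂) H : ℝ) : EReal)) ∧
    (R₁ + R₂ < H →
      DistStorage.privacyExponent v ρ R₁ R₂ (DistStorage.blockPMF μ X Y hX hY) = ⊥) :=
  ⟨DistStorage.privacyExponent_eq v hρ hH hR₁ hR₂, DistStorage.privacyExponent_eq_bot v hρ hH⟩
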